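/- A \emph{countable stochastic game} $\mathcal G$ consists of a countable set $S$ of states, partitioned into the states $S_\Box$ of the maximizer, the states $S_\Diamond$ of the minimizer and the random states $S_\bigcirc$; a transition relation ${\longrightarrow}\subseteq S\times S$ such that every state has at least one successor; and, for every $s\in S_\bigcirc$, a probability distribution $P(s)$ over the successors of $s$. The game is \emph{finitely branching} if every state has only finitely many successors. A \emph{strategy} of the maximizer (resp. minimizer) assigns to every finite sequence of states $ws$ with $s\in S_\Box$ (resp. $s\in S_\Diamond$) a probability distribution over the successors of $s$; let $\Sigma$ (resp. $\Pi$) be the set of all strategies of the maximizer (resp. minimizer). A strategy is \emph{memoryless deterministic} (MD) if it is given by a function that maps each state $s$ of the player to a single successor of $s$, which is chosen with probability $1$ after every sequence $ws$. An initial state $s$ and strategies $\sigma\in\Sigma$, $\pi\in\Pi$ induce in the usual way a probability measure $\mathcal P_{\mathcal G,s,\sigma,\pi}$ on the set $S^\omega$ of infinite sequences of states. For $T\subseteq S$ let $\mathrm{B\ddot uchi}(T)=\{s_0s_1\cdots\in S^\omega \mid \forall i\,\exists j\ge i:\ s_j\in T\}$. \textbf{Theorem.} Let $\mathcal G$ be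 a finitely branching countable stochastic game and let $T\subseteq S$. Then there exist an MD strategy $\hat\sigma$ of the maximizer and an MD strategy $\hat\pi$ of the minimizer such that for all states $s\in S$: \[ \forall\,\pi\in\Pi:\ \mathcal P_{\mathcal G,s,\hat\sigma,\pi}(\mathrm{B\ddot uchi}(T))=1 \quad\text{or}\quad \forall\,\sigma\in\Sigma:\ \mathcal P_{\mathcal G,s,\sigma,\hat\pi}(\mathrm{B\ddot uchi}(T))<1 . \] Hence finitely branching almost-sure Büchi games are strongly MD-determined: for every state $s$, either there is an MD strategy $\sigma$ of the maximizer such that $\mathcal P_{\mathcal G,s,\sigma,\pi}(\mathrm{B\ddot uchi}(T))\ge 1$ for all $\pi\in\Pi$, or there is an MD strategy $\pi$ of the minimizer such that $\mathcal P_{\mathcal G,s,\sigma,\pi}(\mathrm{B\ddot uchi}(T))<1$ for all $\sigma\in\Sigma$. -/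

import Mathlib

open MeasureTheory ProbabilityTheory
open scoped ENNReal

/-- The two players: `max` is the maximizer (box), `min` is the minimizer (diamond). -/
inductive Player where
  | max
  | min

/-- A turn-based stochastic game (2½-player game) with state space `S`.
`owner s = some p` means that `s` belongs to player `p`, and `owner s = none` means that `s` is a
random state, so that `S` is partitioned into three sets (each possibly empty). -/
structure StochasticGame (S : Type*) where
  /-- Who owns a state (`none`: random). -/
  owner : S → Option Player
  /-- The transition relation. -/
  trans : S → S → Prop
  /-- Every state has a successor. -/
  exists_succ : ∀ s, ∃ s', trans s s'
  /-- The probability distribution of a random state. -/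
  prob : ∀ s, owner s = none → PMF S
  /-- It is a distribution over the successors of that state. -/
  prob_support : ∀ s (h : owner s = none), (prob s h).support ⊆ {s' | trans s s'}

namespace StochasticGame

variable {S : Type*}

/-- Each state has only finitely many successors. -/
def FinitelyBranching (G : StochasticGame S) : Prop :=
  ∀ s, {s' | G.trans s s'}.Finite

/-- A (history-dependent, randomized) strategy of player `p`: to a finite sequence `w` of states
followed by a state `s` owned by `p`, i.e. to `ws`, it assigns a distribution over the
successors of `s`. -/
structure Strategy (G : StochasticGame S) (p : Player) where
  /-- The distribution chosen after the history `ws`. -/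
  move : ∀ (_w : List S) (s : S), G.owner s = some p → PMF S
  /-- Only successors are chosen. -/
  move_support : ∀ w s (h : G.owner s = some p), (move w s h).support ⊆ {s' | G.trans s s'}

/-- A strategy is memoryless deterministic (MD) if it is given by a function that maps each state
of the player to a single next state, regardless of the history. -/
def Strategy.IsMD {G : StochasticGame S} {p : Player} (τ : G.Strategy p) : Prop :=
  ∃ f : ∀ s, G.owner s = some p → S, ∀ w s (h : G.owner s = some p), τ.move w s h = PMF.pure (f s h)

/-- The distribution of the next state after the history `ws`, given the strategies of the
two players. -/
def step (G : StochasticGame S) (σ : G.Strategy .max) (π : G.Strategy .min)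
    (w : List S) (s : S) : PMF S :=
  match h : G.owner s with
  | some .max => σ.move w s h
  | some .min => π.move w s h
  | none => G.prob s h

section Measure

/-! The countable set `S` carries the discrete σ-algebra, so the product σ-algebra on `ℕ → S` is
the one generated by the cylinder sets. -/

variable [Countable S] [MeasurableSpace S] [DiscreteMeasurableSpace S]

/-- The transition kernel from the first `n + 1` states `x 0, …, x n` of a play to the next one. -/
noncomputable def stepKernel (G : StochasticGame S) (σ : G.Strategy .max) (π : G.Strategy .min)
    (n : ℕ) : Kernel (Finset.Iic n → S) S :=
  Kernel.ofFunOfCountable fun x =>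
    (G.step σ π (List.ofFn fun i : Fin n => x ⟨i, Finset.mem_Iic.2 i.isLt.le⟩)
      (x ⟨n, Finset.mem_Iic.2 le_rfl⟩)).toMeasure

instance (G : StochasticGame S) (σ : G.Strategy .max) (π : G.Strategy .min) (n : ℕ) :
    IsMarkovKernel (G.stepKernel σ π n) :=
  ⟨fun _ => PMF.toMeasure.isProbabilityMeasure _⟩

/-- The probability measure on infinite sequences of states that is induced by the initial state
`s` and the strategies `σ` and `π` (constructed with the Ionescu-Tulcea theorem). -/
noncomputable def playMeasure (G : StochasticGame S) (s : S) (σ : G.Strategy .max)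
    (π : G.Strategy .min) : Measure (ℕ → S) :=
  Kernel.traj (X := fun _ => S) (G.stepKernel σ π) 0 fun _ => s

/-- The game with the threshold objective `(E, ▷ c)` is strongly MD-determined: in every state one
of the two players has an MD strategy that is winning from this state. -/
def StronglyMDDetermined (G : StochasticGame S) (E : Set (ℕ → S)) (rel : ℝ≥0∞ → ℝ≥0∞ → Prop)
    (c : ℝ≥0∞) : Prop :=
  ∀ s : S,
    (∃ σ : G.Strategy .max, σ.IsMD ∧ ∀ π : G.Strategy .min, rel (G.playMeasure s σ π E) c) ∨
    (∃ π : G.Strategy .min, π.IsMD ∧ ∀ σ : G.Strategy .max, ¬ rel (G.playMeasure s σ π E) c)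

end Measure

end StochasticGame

/-- The Büchi objective: the sequences of states that visit `T` infinitely often. -/
def buchi {S : Type*} (T : Set S) : Set (ℕ → S) :=
  {w | ∀ i, ∃ j ≥ i, w j ∈ T}

/-! Call `L` spoiling if a memoryless rule on `L` keeps the Büchi probability below one from every
state of `L`, whatever the minimizer does outside `L`. Because of this indifference, chains of
spoiling sets with compatible rules have upper bounds, and Zorn's lemma gives a maximal `L`.

Let `u` be the value of reaching `T` without visiting `L`. If the one-step value of `u` at `s` is
below one, then `s` can be added to `L` (`IsSpoiling.extend`): the minimizer moves to a successor of
minimal `u`. A play that won almost surely would never meet `L`, since almost-sure Büchi passes on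
to all successors of positive probability, so reaching `T` would be bounded by `u`. By maximality,
the one-step value of `u` is one outside `L`. It is the one-step value that matters, since `u` is
trivially one on `T \ L`.

Hence outside `L` random and minimizer moves cannot enter `L`, and the maximizer can avoid `L` while
all values of reaching `T ∪ L` are one. It remains to find one memoryless selection that attains
value one for reachability everywhere (`exists_selection_value_one`); following it forever yields
Büchi. Discounting gives a selection that is nearly optimal for a single state. It is frozen where
it guarantees at least `1/2`, which keeps all values at one, and the states are treated one after
the other. The limit selection guarantees `1/2` everywhere, hence one by the zero-one law
`reachValue_eq_one_of_half_le`. -/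

namespace StochasticGame

/-! ### First-step decomposition of the play measure -/

section Play

variable {S : Type*} {G : StochasticGame S}

/-- The strategy that is left of `τ` after the state `s` has been visited. -/
def Strategy.shift {p : Player} (τ : G.Strategy p) (s : S) : G.Strategy p where
  move w t h := τ.move (s :: w) t h
  move_support w t h := τ.move_support (s :: w) t h

theorem step_shift (σ : G.Strategy .max) (π : G.Strategy .min) (s : S) (w : List S) (t : S) :
    G.step (σ.shift s) (π.shift s) w t = G.step σ π (s :: w) t := by
  unfold step Strategy.shift
  split <;> rfl

/-- The plays that agree with `a` up to time `n`. -/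
def cylinderSet (a : ℕ → S) (n : ℕ) : Set (ℕ → S) := {x | ∀ i ≤ n, x i = a i}

theorem cylinderSet_anti (a : ℕ → S) : Antitone (cylinderSet a) :=
  fun _ _ h _ hx i hi => hx i (hi.trans h)

theorem cylinderSet_eq_preimage (a : ℕ → S) (n : ℕ) :
    cylinderSet a n = Preorder.frestrictLe (π := fun _ : ℕ => S) n ⁻¹'
      {Preorder.frestrictLe (π := fun _ : ℕ => S) n a} := by
  ext x
  simp only [cylinderSet, Set.mem_ofPred_eq, Set.mem_preimage, Set.mem_singleton_iff, funext_iff,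
    Preorder.frestrictLe_apply, Subtype.forall, Finset.mem_Iic]

/-- The play that starts in `s` and goes on as `x`. -/
def consPlay (s : S) (x : ℕ → S) : ℕ → S
  | 0 => s
  | n + 1 => x n

variable [MeasurableSpace S]

theorem measurable_consPlay (s : S) : Measurable (consPlay s) := by
  refine measurable_pi_lambda _ fun n => ?_
  cases n with
  | zero => exact measurable_const
  | succ n => exact measurable_pi_apply n

theorem measurable_frestrictLe_pi (n : ℕ) :
    Measurable (Preorder.frestrictLe (π := fun _ : ℕ => S) n) :=
  Preorder.measurable_frestrictLe n

variable [Countable S] [DiscreteMeasurableSpace S]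

instance (s : S) (σ : G.Strategy .max) (π : G.Strategy .min) :
    IsProbabilityMeasure (G.playMeasure s σ π) := by
  unfold playMeasure; infer_instance

theorem measurableSet_cylinderSet (a : ℕ → S) (n : ℕ) : MeasurableSet (cylinderSet a n) := by
  rw [cylinderSet_eq_preimage]
  exact measurable_frestrictLe_pi n (MeasurableSet.singleton _)

theorem playMeasure_cylinderSet_zero (s : S) (σ : G.Strategy .max) (π : G.Strategy .min)
    (a : ℕ → S) : G.playMeasure s σ π (cylinderSet a 0) = ({s} : Set S).indicator 1 (a 0) := by
  rw [cylinderSet_eq_preimage, ← Measure.map_apply (measurable_frestrictLe_pi 0)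
    (MeasurableSet.singleton _), playMeasure, Kernel.traj_map_frestrictLe_apply,
    Kernel.partialTraj_self, Kernel.id_apply, Measure.dirac_apply' _ (MeasurableSet.singleton _)]
  by_cases h : a 0 = s
  · have : (fun _ => s : Finset.Iic 0 → S) = Preorder.frestrictLe (π := fun _ : ℕ => S) 0 a := by
      ext ⟨i, hi⟩
      obtain rfl : i = 0 := by simpa using hi
      simp [h]
    simp [h, ← this]
  · have : (fun _ => s : Finset.Iic 0 → S) ≠ Preorder.frestrictLe (π := fun _ : ℕ => S) 0 a := by
      intro h'
      exact h (congrFun h' ⟨0, by simp⟩).symm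
    simp [h, this]

theorem playMeasure_cylinderSet_succ (s : S) (σ : G.Strategy .max) (π : G.Strategy .min)
    (a : ℕ → S) (n : ℕ) : G.playMeasure s σ π (cylinderSet a (n + 1)) =
      G.playMeasure s σ π (cylinderSet a n) *
        G.step σ π (List.ofFn fun i : Fin n => a i) (a n) (a (n + 1)) := by
  have key := Kernel.partialTraj_compProd_eq_map_traj (κ := G.stepKernel σ π)
    (X := fun _ => S) (Nat.zero_le n) (x₀ := fun _ => s)
  have hm : Measurable fun x : ℕ → S =>
      (Preorder.frestrictLe (π := fun _ : ℕ => S) n x, x (n + 1)) :=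
    (measurable_frestrictLe_pi n).prodMk (measurable_pi_apply _)
  have h1 : cylinderSet a (n + 1) = (fun x : ℕ → S =>
      (Preorder.frestrictLe (π := fun _ : ℕ => S) n x, x (n + 1))) ⁻¹'
      ({Preorder.frestrictLe (π := fun _ : ℕ => S) n a} ×ˢ {a (n + 1)}) := by
    ext x
    have : x ∈ cylinderSet a (n + 1) ↔ x ∈ cylinderSet a n ∧ x (n + 1) = a (n + 1) := by
      simp only [cylinderSet, Set.mem_ofPred_eq, Nat.le_succ_iff]
      constructor
      · exact fun h => ⟨fun i hi => h i (Or.inl hi), h _ (Or.inr rfl)⟩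
      · rintro ⟨h, h'⟩ i (hi | rfl)
        exacts [h i hi, h']
    rw [this, cylinderSet_eq_preimage]
    simp
  have h2 := congrArg (fun μ => μ ({Preorder.frestrictLe (π := fun _ : ℕ => S) n a} ×ˢ
    {a (n + 1)})) key
  have hs1 := MeasurableSet.singleton (Preorder.frestrictLe (π := fun _ : ℕ => S) n a)
  have hs2 := MeasurableSet.singleton (a (n + 1))
  rw [Measure.map_apply hm (hs1.prod hs2), ← h1, Measure.compProd_apply_prod hs1 hs2,
    lintegral_singleton, ← Kernel.traj_map_frestrictLe_apply,
    Measure.map_apply (measurable_frestrictLe_pi n) (MeasurableSet.singleton _),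
    ← cylinderSet_eq_preimage] at h2
  rw [playMeasure, ← h2, mul_comm]
  congr 1
  exact PMF.toMeasure_apply_singleton (G.step σ π (List.ofFn fun i : Fin n => a i) (a n)) _ hs2

/-- The recursion in the last step turns, by induction on the length, into a recursion in the first
step. -/
theorem playMeasure_cylinderSet_succ' (s : S) (σ : G.Strategy .max) (π : G.Strategy .min)
    (a : ℕ → S) (n : ℕ) : G.playMeasure s σ π (cylinderSet a (n + 1)) =
      ({s} : Set S).indicator 1 (a 0) * (G.step σ π [] s (a 1) *
        G.playMeasure (a 1) (σ.shift s) (π.shift s) (cylinderSet (fun i => a (i + 1)) n)) := by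
  by_cases h0 : a 0 = s
  swap
  · have hz : G.playMeasure s σ π (cylinderSet a 0) = 0 := by
      rw [playMeasure_cylinderSet_zero]; simp [h0]
    have : G.playMeasure s σ π (cylinderSet a (n + 1)) = 0 :=
      measure_mono_null (cylinderSet_anti _ (Nat.zero_le _)) hz
    simp [this, h0]
  induction n with
  | zero =>
    rw [playMeasure_cylinderSet_succ, playMeasure_cylinderSet_zero, playMeasure_cylinderSet_zero]
    simp [h0]
  | succ n ih =>
    rw [playMeasure_cylinderSet_succ, ih,
      playMeasure_cylinderSet_succ (a := fun i => a (i + 1)), step_shift]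
    have : (List.ofFn fun i : Fin (n + 1) => a i) = s :: List.ofFn fun i : Fin n => a (i + 1) := by
      simp [List.ofFn_succ, h0]
    rw [this]
    simp only [mul_assoc]

/-- A play makes its first step, and goes on with the shifted strategies. -/
theorem playMeasure_eq_sum (s : S) (σ : G.Strategy .max) (π : G.Strategy .min) :
    G.playMeasure s σ π = Measure.sum fun t => G.step σ π [] s t •
      (G.playMeasure t (σ.shift s) (π.shift s)).map (consPlay s) := by
  set ν := Measure.sum fun t => G.step σ π [] s t •
      (G.playMeasure t (σ.shift s) (π.shift s)).map (consPlay s) with hν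
  have hcyl : ∀ (a : ℕ → S) n, G.playMeasure s σ π (cylinderSet a (n + 1)) =
      ν (cylinderSet a (n + 1)) := by
    intro a n
    rw [hν, Measure.sum_apply _ (measurableSet_cylinderSet _ _), playMeasure_cylinderSet_succ']
    simp only [Measure.smul_apply, smul_eq_mul, Measure.map_apply (measurable_consPlay s)
      (measurableSet_cylinderSet a (n + 1))]
    have hpre : consPlay s ⁻¹' cylinderSet a (n + 1) =
        {x | a 0 = s ∧ x ∈ cylinderSet (fun i => a (i + 1)) n} := by
      ext x
      simp only [cylinderSet, Set.mem_preimage, Set.mem_ofPred_eq]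
      constructor
      · intro h
        exact ⟨(h 0 (by omega)).symm, fun i hi => h (i + 1) (by omega)⟩
      · rintro ⟨h0, h⟩ i hi
        cases i with
        | zero => exact h0.symm
        | succ i => exact h i (by omega)
    rw [hpre]
    by_cases h0 : a 0 = s
    swap
    · simp [h0]
    simp only [h0, true_and, Set.ofPred_mem_eq, Set.mem_singleton_iff, Set.indicator_of_mem,
      Pi.one_apply, one_mul]
    rw [tsum_eq_single (a 1)]
    intro t ht
    have hz : G.playMeasure t (σ.shift s) (π.shift s) (cylinderSet (fun i => a (i + 1)) 0) = 0 := by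
      rw [playMeasure_cylinderSet_zero]; simp [ht.symm]
    rw [measure_mono_null (cylinderSet_anti _ (Nat.zero_le _)) hz, mul_zero]
  have hmap : ∀ n, ν.map (Preorder.frestrictLe (π := fun _ : ℕ => S) (n + 1)) =
      (G.playMeasure s σ π).map (Preorder.frestrictLe (π := fun _ : ℕ => S) (n + 1)) := by
    intro n
    refine Measure.ext_of_singleton fun b => ?_
    have : ∃ a : ℕ → S, Preorder.frestrictLe (π := fun _ : ℕ => S) (n + 1) a = b :=
      ⟨fun i => if h : i ∈ Finset.Iic (n + 1) then b ⟨i, h⟩ else s, by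
        ext ⟨i, hi⟩; simp only [Preorder.frestrictLe_apply, dif_pos hi]⟩
    obtain ⟨a, rfl⟩ := this
    rw [Measure.map_apply (measurable_frestrictLe_pi _) (MeasurableSet.singleton _),
      Measure.map_apply (measurable_frestrictLe_pi _) (MeasurableSet.singleton _),
      ← cylinderSet_eq_preimage, hcyl]
  have : ∀ n, IsFiniteMeasure (Kernel.partialTraj (X := fun _ => S) (G.stepKernel σ π) 0 n
      fun _ => s) := fun n => by
    rw [← Kernel.traj_map_frestrictLe_apply]; infer_instance
  have : ∀ I, IsFiniteMeasure (inducedFamily (X := fun _ => S) (fun n => Kernel.partialTraj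
      (X := fun _ => S) (G.stepKernel σ π) 0 n fun _ => s) I) := fun I => by
    rw [inducedFamily]; infer_instance
  have hproj := Kernel.isProjectiveLimit_trajFun (X := fun _ => S) (G.stepKernel σ π) 0 fun _ => s
  -- Marginals up to time `n ≥ 1` determine the measure; the cylinder identity is available only
  -- when the first step is included.
  refine hproj.unique ((isProjectiveLimit_nat_iff'
    (Kernel.isProjectiveMeasureFamily_partialTraj _ _) _ 1).2 fun n hn => ?_)
  obtain ⟨n, rfl⟩ : ∃ m, n = m + 1 := ⟨n - 1, by omega⟩
  rw [hmap, inducedFamily_Iic, playMeasure, Kernel.traj_map_frestrictLe_apply]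

theorem playMeasure_apply (s : S) (σ : G.Strategy .max) (π : G.Strategy .min)
    {A : Set (ℕ → S)} (hA : MeasurableSet A) :
    G.playMeasure s σ π A = ∑' t, G.step σ π [] s t *
      G.playMeasure t (σ.shift s) (π.shift s) (consPlay s ⁻¹' A) := by
  conv_lhs => rw [playMeasure_eq_sum, Measure.sum_apply _ hA]
  simp only [Measure.smul_apply, smul_eq_mul, Measure.map_apply (measurable_consPlay s) hA]

/-- A play starts in its initial state. -/
theorem playMeasure_start (s : S) (σ : G.Strategy .max) (π : G.Strategy .min) :
    G.playMeasure s σ π {x | x 0 = s} = 1 := by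
  have := playMeasure_cylinderSet_zero s σ π (G := G) fun _ => s
  simpa [cylinderSet] using this

end Play

/-! ### Reachability values of abstract one-step operators -/

section ValueOperator

variable {S : Type*}

/-- A monotone, ω-continuous operator on expectations that preserves the bound `1`. -/
structure IsContOperator (B : (S → ℝ≥0∞) → S → ℝ≥0∞) : Prop where
  mono : Monotone B
  cont : ∀ f : ℕ → S → ℝ≥0∞, Monotone f → ∀ s, B (fun t => ⨆ n, f n t) s ≤ ⨆ n, B (f n) s
  le_one : ∀ s, B (fun _ => 1) s ≤ 1

/-- An operator that commutes with affine maps. -/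
def IsAffineOperator (B : (S → ℝ≥0∞) → S → ℝ≥0∞) : Prop :=
  ∀ (a b : ℝ≥0∞) (f : S → ℝ≥0∞) (s : S), b ≠ 0 → b ≠ ∞ →
    B (fun t => a + b * f t) s = a + b * B f s

open Classical in
/-- The value of reaching `X` in at most `n` steps, where `B` computes the value of one step. -/
noncomputable def reachWithin (B : (S → ℝ≥0∞) → S → ℝ≥0∞) (X : Set S) : ℕ → S → ℝ≥0∞
  | 0 => X.indicator 1
  | n + 1 => fun s => if s ∈ X then 1 else B (reachWithin B X n) s

/-- The value of reaching `X`. -/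
noncomputable def reachValue (B : (S → ℝ≥0∞) → S → ℝ≥0∞) (X : Set S) (s : S) : ℝ≥0∞ :=
  ⨆ n, reachWithin B X n s

variable {B B' : (S → ℝ≥0∞) → S → ℝ≥0∞} {X : Set S}

theorem reachWithin_of_mem {s : S} (hs : s ∈ X) (n : ℕ) : reachWithin B X n s = 1 := by
  cases n <;> simp [reachWithin, hs]

theorem reachWithin_zero_of_notMem {s : S} (hs : s ∉ X) : reachWithin B X 0 s = 0 := by
  simp [reachWithin, hs]

theorem reachWithin_succ_of_notMem {s : S} (hs : s ∉ X) (n : ℕ) :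
    reachWithin B X (n + 1) s = B (reachWithin B X n) s := by
  simp [reachWithin, hs]

theorem reachWithin_mono (hB : Monotone B) : Monotone (reachWithin B X) := by
  refine monotone_nat_of_le_succ fun n => ?_
  induction n with
  | zero =>
    intro s
    by_cases hs : s ∈ X
    · simp [reachWithin_of_mem hs]
    · simp [reachWithin_zero_of_notMem hs]
  | succ n ih =>
    intro s
    by_cases hs : s ∈ X
    · simp [reachWithin_of_mem hs]
    · rw [reachWithin_succ_of_notMem hs, reachWithin_succ_of_notMem hs]
      exact hB ih s

theorem reachWithin_le_reachValue (n : ℕ) (s : S) : reachWithin B X n s ≤ reachValue B X s :=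
  le_iSup (fun n => reachWithin B X n s) n

theorem reachValue_of_mem {s : S} (hs : s ∈ X) : reachValue B X s = 1 := by
  simp [reachValue, reachWithin_of_mem hs]

/-- `reachValue` is below every supersolution. -/
theorem reachWithin_le_of_superharmonic (hB : Monotone B) {f : S → ℝ≥0∞}
    (h1 : ∀ s ∈ X, 1 ≤ f s) (h2 : ∀ s ∉ X, B f s ≤ f s) (n : ℕ) (s : S) :
    reachWithin B X n s ≤ f s := by
  induction n generalizing s with
  | zero =>
    by_cases hs : s ∈ X
    · simpa [reachWithin_of_mem hs] using h1 s hs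
    · simp [reachWithin_zero_of_notMem hs]
  | succ n ih =>
    by_cases hs : s ∈ X
    · simpa [reachWithin_of_mem hs] using h1 s hs
    · rw [reachWithin_succ_of_notMem hs]
      exact (hB ih s).trans (h2 s hs)

theorem reachValue_le_of_superharmonic (hB : Monotone B) {f : S → ℝ≥0∞}
    (h1 : ∀ s ∈ X, 1 ≤ f s) (h2 : ∀ s ∉ X, B f s ≤ f s) (s : S) : reachValue B X s ≤ f s :=
  iSup_le fun n => reachWithin_le_of_superharmonic hB h1 h2 n s

theorem reachValue_le_one (hB : IsContOperator B) (s : S) : reachValue B X s ≤ 1 :=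
  reachValue_le_of_superharmonic hB.mono (f := fun _ => 1) (fun _ _ => le_rfl)
    (fun s _ => hB.le_one s) s

/-- The inequality `≥` is where ω-continuity is needed. -/
theorem reachValue_of_notMem (hB : IsContOperator B) {s : S} (hs : s ∉ X) :
    reachValue B X s = B (reachValue B X) s := by
  apply le_antisymm
  · refine iSup_le fun n => ?_
    refine (reachWithin_mono hB.mono n.le_succ s).trans ?_
    rw [reachWithin_succ_of_notMem hs]
    exact hB.mono (fun t => reachWithin_le_reachValue n t) s
  · refine (hB.cont _ (reachWithin_mono hB.mono) s).trans (iSup_le fun n => ?_)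
    rw [← reachWithin_succ_of_notMem (B := B) hs]
    exact reachWithin_le_reachValue _ s

/-- Zero-one law: if the value is bounded away from zero, then it is one. -/
theorem reachValue_eq_one_of_half_le (hB : IsContOperator B) (hA : IsAffineOperator B)
    (h : ∀ s, 2⁻¹ ≤ reachValue B X s) (s : S) : reachValue B X s = 1 := by
  -- Affinity carries this through the induction. In the limit, the value `v` satisfies `1/2 + v/2 ≤
  -- v`, so `v ≥ 1`.
  have key : ∀ n s, 2⁻¹ + 2⁻¹ * reachWithin B X n s ≤ reachValue B X s := by
    intro n
    induction n with
    | zero =>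
      intro s
      by_cases hs : s ∈ X
      · simp [reachWithin_of_mem hs, reachValue_of_mem hs, ENNReal.inv_two_add_inv_two]
      · simpa [reachWithin_zero_of_notMem hs] using h s
    | succ n ih =>
      intro s
      by_cases hs : s ∈ X
      · simp [reachWithin_of_mem hs, reachValue_of_mem hs, ENNReal.inv_two_add_inv_two]
      · rw [reachWithin_succ_of_notMem hs, ← hA _ _ _ _ (by simp) (by simp),
          reachValue_of_notMem hB hs]
        exact hB.mono ih s
  have h1 := reachValue_le_one hB (X := X) s
  have h2 : 2⁻¹ + 2⁻¹ * reachValue B X s ≤ reachValue B X s := by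
    conv_lhs => rw [reachValue, ENNReal.mul_iSup, ENNReal.add_iSup]
    exact iSup_le fun n => key n s
  refine le_antisymm h1 ?_
  have h3 : reachValue B X s ≠ ∞ := ne_top_of_le_ne_top ENNReal.one_ne_top h1
  generalize reachValue B X s = u at *
  lift u to NNReal using h3
  have h4 := ENNReal.toReal_mono ENNReal.coe_ne_top h2
  rw [ENNReal.toReal_add (by simp) (ENNReal.mul_ne_top (by simp) (by simp)),
    ENNReal.toReal_mul] at h4
  simp only [ENNReal.toReal_inv, ENNReal.toReal_ofNat, ENNReal.coe_toReal] at h4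
  have h5 : (1 : ℝ) ≤ u := by linarith
  exact_mod_cast h5

end ValueOperator

/-! ### Bellman operators -/

section Operators

variable {S : Type*} {C : S → Set S}

/-- The best value of a successor in `C s`. -/
noncomputable def supOver (C : S → Set S) (f : S → ℝ≥0∞) (s : S) : ℝ≥0∞ := ⨆ t : C s, f t

/-- The worst value of a successor in `C s`. -/
noncomputable def infOver (C : S → Set S) (f : S → ℝ≥0∞) (s : S) : ℝ≥0∞ := ⨅ t : C s, f t

theorem supOver_isContOperator (C : S → Set S) : IsContOperator (supOver C) where
  mono _ _ h _ := iSup_mono fun t => h t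
  cont f _ s := by
    unfold supOver
    rw [iSup_comm]
  le_one s := iSup_le fun _ => le_rfl

/-- An empty supremum is zero and would lose the constant `a`; hence the nonemptiness. -/
theorem supOver_isAffineOperator (hC : ∀ s, (C s).Nonempty) : IsAffineOperator (supOver C) := by
  intro a b f s _ _
  have := (hC s).to_subtype
  unfold supOver
  rw [ENNReal.mul_iSup, ENNReal.add_iSup]

/-- Increasing suprema commute with finite infima: finite branching is essential here. -/
theorem infOver_isContOperator (hC : ∀ s, (C s).Nonempty) (hf : ∀ s, (C s).Finite) :
    IsContOperator (infOver C) where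
  mono _ _ h _ := iInf_mono fun t => h t
  cont f h s := by
    have := (hf s).to_subtype
    unfold infOver
    rw [iSup_iInf_of_monotone (f := fun (t : C s) n => f n t) fun t _ _ hmn => h hmn t]
  le_one s := by
    have := (hC s).to_subtype
    simp [infOver]

theorem infOver_isAffineOperator (C : S → Set S) : IsAffineOperator (infOver C) := by
  intro a b f s h0 ht
  unfold infOver
  rw [ENNReal.mul_iInf_of_ne h0 ht, ENNReal.add_iInf]

theorem infOver_singleton (g : S → S) (f : S → ℝ≥0∞) (s : S) :
    infOver (fun s => {g s}) f s = f (g s) := by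
  simp [infOver]

theorem PMF.tsum_mul_add (p : PMF S) (a b : ℝ≥0∞) (f : S → ℝ≥0∞) :
    ∑' t, p t * (a + b * f t) = a + b * ∑' t, p t * f t := by
  simp_rw [mul_add, ENNReal.tsum_add, ENNReal.tsum_mul_right, p.tsum_coe, one_mul,
    mul_left_comm _ b, ENNReal.tsum_mul_left]

theorem PMF.tsum_mul_iSup_le (p : PMF S) (f : ℕ → S → ℝ≥0∞) (hf : Monotone f) :
    ∑' t, p t * ⨆ n, f n t ≤ ⨆ n, ∑' t, p t * f n t := by
  let _ : MeasurableSpace S := ⊤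
  simp_rw [ENNReal.mul_iSup, ← MeasureTheory.lintegral_count]
  rw [lintegral_iSup (f := fun n t => p t * f n t) (fun n => measurable_from_top)
    (fun m n h t => mul_le_mul_right (hf h t) _)]

variable (G : StochasticGame S)

/-- The successors of `s`. -/
def succs (s : S) : Set S := {t | G.trans s t}

theorem succs_nonempty (s : S) : (G.succs s).Nonempty := G.exists_succ s

/-- The value of one step of the game, where `M` describes the behaviour of the maximizer. -/
noncomputable def bellman (M : (S → ℝ≥0∞) → S → ℝ≥0∞) (f : S → ℝ≥0∞) (s : S) : ℝ≥0∞ :=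
  match h : G.owner s with
  | some .max => M f s
  | some .min => infOver G.succs f s
  | none => ∑' t, G.prob s h t * f t

variable {G} {M : (S → ℝ≥0∞) → S → ℝ≥0∞}

theorem bellman_max {s : S} (h : G.owner s = some .max) (f : S → ℝ≥0∞) :
    G.bellman M f s = M f s := by
  unfold bellman; split <;> simp_all

theorem bellman_min {s : S} (h : G.owner s = some .min) (f : S → ℝ≥0∞) :
    G.bellman M f s = infOver G.succs f s := by
  unfold bellman; split <;> simp_all

theorem bellman_random {s : S} (h : G.owner s = none) (f : S → ℝ≥0∞) :
    G.bellman M f s = ∑' t, G.prob s h t * f t := by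
  unfold bellman; split <;> simp_all

theorem owner_cases (G : StochasticGame S) (s : S) :
    G.owner s = some .max ∨ G.owner s = some .min ∨ G.owner s = none := by
  rcases G.owner s with _ | _ | _ <;> simp

theorem bellman_mono (hM : Monotone M) : Monotone (G.bellman M) := by
  intro f g hfg s
  rcases G.owner_cases s with h | h | h
  · simpa only [bellman_max h] using hM hfg s
  · simp only [bellman_min h]
    exact iInf_mono fun t => hfg t
  · simp only [bellman_random h]
    exact ENNReal.tsum_le_tsum fun t => mul_le_mul_right (hfg t) _

theorem bellman_le_bellman {M' : (S → ℝ≥0∞) → S → ℝ≥0∞} {f : S → ℝ≥0∞} {s : S}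
    (h : G.owner s = some .max → M f s ≤ M' f s) : G.bellman M f s ≤ G.bellman M' f s := by
  rcases G.owner_cases s with hs | hs | hs
  · simpa only [bellman_max hs] using h hs
  · simp only [bellman_min hs, le_rfl]
  · simp only [bellman_random hs, le_rfl]

theorem bellman_isContOperator (hG : G.FinitelyBranching) (hM : IsContOperator M) :
    IsContOperator (G.bellman M) where
  mono := bellman_mono hM.mono
  cont f hf s := by
    rcases G.owner_cases s with h | h | h
    · simpa only [bellman_max h] using hM.cont f hf s
    · simpa only [bellman_min h] using (infOver_isContOperator G.succs_nonempty hG).cont f hf s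
    · simpa only [bellman_random h] using PMF.tsum_mul_iSup_le _ f hf
  le_one s := by
    rcases G.owner_cases s with h | h | h
    · simpa only [bellman_max h] using hM.le_one s
    · simpa only [bellman_min h] using (infOver_isContOperator G.succs_nonempty hG).le_one s
    · simp only [bellman_random h, mul_one, PMF.tsum_coe, le_rfl]

theorem bellman_isAffineOperator (hM : IsAffineOperator M) : IsAffineOperator (G.bellman M) := by
  intro a b f s h0 ht
  rcases G.owner_cases s with h | h | h
  · simpa only [bellman_max h] using hM a b f s h0 ht
  · simpa only [bellman_min h] using infOver_isAffineOperator _ a b f s h0 ht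
  · simpa only [bellman_random h] using PMF.tsum_mul_add _ a b f

end Operators

/-! ### Memoryless selections for reachability -/

section Selection

variable {S : Type*} {G : StochasticGame S} {C : S → Set S} {X : Set S}

theorem IsAffineOperator.const_mul {B : (S → ℝ≥0∞) → S → ℝ≥0∞} (hA : IsAffineOperator B)
    {b : ℝ≥0∞} (h0 : b ≠ 0) (ht : b ≠ ∞) (f : S → ℝ≥0∞) (s : S) :
    B (fun t => b * f t) s = b * B f s := by
  simpa using hA 0 b f s h0 ht

/-- A function that is below its discounted one-step value, with the maximizer following `g`, is
below the value that `g` guarantees. -/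
theorem le_reachValue_of_le_discounted {B : (S → ℝ≥0∞) → S → ℝ≥0∞} (hB : Monotone B)
    (hA : IsAffineOperator B) {l : ℝ≥0∞} (h1 : l < 1) {f : S → ℝ≥0∞}
    (hf : ∀ s, f s ≤ 1) (hfB : ∀ s ∉ X, f s ≤ l * B f s) (s : S) : f s ≤ reachValue B X s := by
  -- Unrolling `n` steps leaves a remainder of at most `l ^ n`, as `f ≤ 1`.
  have key : ∀ n s, f s ≤ l ^ n + reachWithin B X n s := by
    intro n
    induction n with
    | zero => intro s; simpa using le_add_right (hf s)
    | succ n ih =>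
      intro s
      by_cases hs : s ∈ X
      · rw [reachWithin_of_mem hs]
        exact le_add_left (hf s)
      · calc f s ≤ l * B f s := hfB s hs
          _ ≤ l * B (fun t => l ^ n + 1 * reachWithin B X n t) s := by
            gcongr
            exact hB (fun t => by simpa using ih t) s
          _ = l ^ (n + 1) + l * B (reachWithin B X n) s := by
            rw [hA _ _ _ _ (by simp) (by simp), one_mul, mul_add, pow_succ']
          _ ≤ l ^ (n + 1) + reachWithin B X (n + 1) s := by
            rw [reachWithin_succ_of_notMem hs]
            gcongr
            exact mul_le_of_le_one_left' h1.le
  have hlim : Filter.Tendsto (fun n : ℕ => l ^ n + reachValue B X s) Filter.atTop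
      (nhds (0 + reachValue B X s)) :=
    (ENNReal.tendsto_pow_atTop_nhds_zero_of_lt_one h1).add tendsto_const_nhds
  rw [zero_add] at hlim
  refine ge_of_tendsto' hlim fun n => (key n s).trans ?_
  gcongr
  exact reachWithin_le_reachValue n s

theorem exists_discount (n : ℕ) {c : ℝ≥0∞} (hc : c < 1) :
    ∃ l : ℝ≥0∞, l ≠ 0 ∧ l < 1 ∧ c < l ^ n := by
  have h1 : ∀ᶠ l : ℝ≥0∞ in nhdsWithin 1 (Set.Iio 1), c < l ^ n := by
    have : Filter.Tendsto (fun l : ℝ≥0∞ => l ^ n) (nhdsWithin 1 (Set.Iio 1)) (nhds (1 ^ n)) :=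
      ((ENNReal.continuous_pow n).tendsto 1).mono_left nhdsWithin_le_nhds
    exact this.eventually_const_lt (by simpa using hc)
  have h2 : ∀ᶠ l : ℝ≥0∞ in nhdsWithin 1 (Set.Iio 1), 0 < l :=
    nhdsWithin_le_nhds (lt_mem_nhds one_pos)
  have : (nhdsWithin (1 : ℝ≥0∞) (Set.Iio 1)).NeBot := nhdsLT_neBot_of_exists_lt ⟨0, one_pos⟩
  obtain ⟨l, ⟨ha, hb⟩, hd⟩ := ((h1.and h2).and self_mem_nhdsWithin).exists
  exact ⟨l, hb.ne', hd, ha⟩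

/-- In a state of value one the maximizer has an MD strategy that guarantees `3/4`. -/
theorem exists_selection_near_optimal (hG : G.FinitelyBranching) (hC : ∀ s, (C s).Nonempty)
    (hf : ∀ s, (C s).Finite) {s₀ : S} (h : reachValue (G.bellman (supOver C)) X s₀ = 1) :
    ∃ g : S → S, (∀ s, g s ∈ C s) ∧
      3 / 4 ≤ reachValue (G.bellman (infOver fun s => {g s})) X s₀ := by
  set B := G.bellman (supOver C) with hBdef
  have hB : IsContOperator B := bellman_isContOperator hG (supOver_isContOperator C)
  have hA : IsAffineOperator B := bellman_isAffineOperator (supOver_isAffineOperator hC)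
  have h78 : (7 / 8 : ℝ≥0∞) < 1 := by
    rw [ENNReal.div_lt_iff (by simp) (by simp)]; norm_num
  -- Horizon and discount each lose a factor `7/8`, and `(7/8)² = 49/64 ≥ 3/4`.
  obtain ⟨n, hn⟩ : ∃ n, 7 / 8 < reachWithin B X n s₀ := by
    rw [← lt_iSup_iff]; exact h78.trans_eq h.symm
  obtain ⟨l, hl0, hl1, hln⟩ := exists_discount n h78
  have hlt : l ≠ ∞ := (hl1.trans ENNReal.one_lt_top).ne
  set f : S → ℝ≥0∞ := fun s => ⨆ n, l ^ n * reachWithin B X n s with hfdef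
  have hf1 : ∀ s, f s ≤ 1 := fun s => iSup_le fun n =>
    mul_le_one' (pow_le_one' hl1.le n)
      ((reachWithin_le_reachValue n s).trans (reachValue_le_one hB s))
  have hfB : ∀ s ∉ X, f s ≤ l * B f s := by
    intro s hs
    refine iSup_le fun n => ?_
    cases n with
    | zero => simp [reachWithin_zero_of_notMem hs]
    | succ n =>
      rw [reachWithin_succ_of_notMem hs, pow_succ', mul_assoc,
        ← hA.const_mul (pow_ne_zero n hl0) (ENNReal.pow_ne_top hlt)]
      gcongr
      exact hB.mono (fun t => le_iSup (fun n => l ^ n * reachWithin B X n t) n) s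
  -- Greedy moves for undiscounted values could postpone the target forever; the discount rules this
  -- out.
  choose g hg hgmax using fun s => Set.exists_max_image (C s) f (hf s) (hC s)
  refine ⟨g, hg, ?_⟩
  have hA' : IsAffineOperator (G.bellman (infOver fun s => {g s})) :=
    bellman_isAffineOperator (infOver_isAffineOperator _)
  have hB' : Monotone (G.bellman (infOver fun s => {g s})) :=
    bellman_mono (infOver_isContOperator (by simp) (by simp)).mono
  refine le_trans ?_ (le_reachValue_of_le_discounted hB' hA' hl1 hf1 (fun s hs => ?_) s₀)
  · refine le_trans ?_ (le_iSup (fun n => l ^ n * reachWithin B X n s₀) n)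
    refine le_trans ?_ (mul_le_mul' hln.le hn.le)
    rw [← ENNReal.toReal_le_toReal (by finiteness) (by finiteness)]
    norm_num
  · refine (hfB s hs).trans ?_
    gcongr
    refine bellman_le_bellman fun _ => ?_
    rw [infOver_singleton]
    exact iSup_le fun t => hgmax s t t.2

theorem supOver_mono_set {C C' : S → Set S} {s : S} (h : C s ⊆ C' s) (f : S → ℝ≥0∞) :
    supOver C f s ≤ supOver C' f s :=
  iSup_le fun t => le_iSup (fun t : C' s => f t) ⟨t, h t.2⟩

theorem infOver_anti_set {C C' : S → Set S} {s : S} (h : C s ⊆ C' s) (f : S → ℝ≥0∞) :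
    infOver C' f s ≤ infOver C f s :=
  le_iInf fun t => iInf_le (fun t : C' s => f t) ⟨t, h t.2⟩

/-- In a game in which every state has value one, the choices of the maximizer can be restricted
such that all values remain one, the choice in `s₀` is fixed, and every strategy that obeys the
restrictions reaches the target from `s₀` with probability at least `1/2`. -/
theorem exists_refinement (hG : G.FinitelyBranching) (hC : ∀ s, (C s).Nonempty)
    (hf : ∀ s, (C s).Finite) (h : ∀ s, reachValue (G.bellman (supOver C)) X s = 1) (s₀ : S) :
    ∃ C' : S → Set S, (∀ s, (C' s).Nonempty) ∧ (∀ s, C' s ⊆ C s) ∧ (∃ t, C' s₀ = {t}) ∧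
      (∀ s, reachValue (G.bellman (supOver C')) X s = 1) ∧
      2⁻¹ ≤ reachValue (G.bellman (infOver C')) X s₀ := by
  classical
  obtain ⟨g, hg, hg34⟩ := exists_selection_near_optimal hG hC hf (h s₀)
  set D : S → Set S := fun s => {g s} with hD
  set w := reachValue (G.bellman (infOver D)) X with hw
  -- Freeze `g` where it guarantees `1/2`, and leave all choices open elsewhere.
  set C' : S → Set S := fun s => if 2⁻¹ ≤ w s then {g s} else C s with hC'
  have hC'n : ∀ s, (C' s).Nonempty := fun s => by
    simp only [hC']; split
    exacts [Set.singleton_nonempty _, hC s]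
  have hC'C : ∀ s, C' s ⊆ C s := fun s => by
    simp only [hC']; split
    exacts [Set.singleton_subset_iff.2 (hg s), subset_rfl]
  have hDC' : ∀ s, D s ⊆ C' s := fun s => by
    simp only [hC', hD]; split
    exacts [subset_rfl, Set.singleton_subset_iff.2 (hg s)]
  have hC'f : ∀ s, (C' s).Finite := fun s => (hf s).subset (hC'C s)
  have hC'pos : ∀ s, 2⁻¹ ≤ w s → C' s = D s := fun s hs => by simp only [hC', hD, if_pos hs]
  have hC'neg : ∀ s, ¬ 2⁻¹ ≤ w s → C' s = C s := fun s hs => by simp only [hC', if_neg hs]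
  have hBD : IsContOperator (G.bellman (infOver D)) :=
    bellman_isContOperator hG (infOver_isContOperator (by simp [hD]) (by simp [hD]))
  have hBU : IsContOperator (G.bellman (supOver C')) :=
    bellman_isContOperator hG (supOver_isContOperator C')
  have hAU : IsAffineOperator (G.bellman (supOver C')) :=
    bellman_isAffineOperator (supOver_isAffineOperator hC'n)
  have hBQ : IsContOperator (G.bellman (infOver C')) :=
    bellman_isContOperator hG (infOver_isContOperator hC'n hC'f)
  have hAQ : IsAffineOperator (G.bellman (infOver C')) :=
    bellman_isAffineOperator (infOver_isAffineOperator _)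
  set u := reachValue (G.bellman (supOver C')) X with hu
  set q := reachValue (G.bellman (infOver C')) X with hq
  have hs₀ : 2⁻¹ ≤ w s₀ := by
    refine le_trans ?_ hg34
    rw [← ENNReal.toReal_le_toReal (by finiteness) (by finiteness)]
    norm_num
  have hwu : ∀ s, w s ≤ u s := by
    refine reachValue_le_of_superharmonic hBD.mono (fun s hs => (reachValue_of_mem hs).ge)
      fun s hs => ?_
    rw [hu, reachValue_of_notMem hBU hs]
    refine bellman_le_bellman fun _ => ?_
    rw [hD, infOver_singleton]
    exact le_iSup (fun t : C' s => u t) ⟨g s, hDC' s rfl⟩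
  -- `2 * u` dominates the original value: where `g` is frozen, `u ≥ w ≥ 1/2`; elsewhere no choice
  -- has been removed.
  have hCu : ∀ s, 1 ≤ 2 * u s := by
    intro s
    rw [← h s]
    have hhalf : ∀ s, 2⁻¹ ≤ u s → 1 ≤ 2 * u s := fun s hs => by
      calc (1 : ℝ≥0∞) = 2 * 2⁻¹ := (ENNReal.mul_inv_cancel (by simp) (by simp)).symm
        _ ≤ 2 * u s := by gcongr
    refine Eq.trans_le ?_ (iSup_le fun n => ?_ : reachValue (G.bellman (supOver C)) X s ≤ 2 * u s)
    · rfl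
    induction n generalizing s with
    | zero =>
      by_cases hs : s ∈ X
      · rw [reachWithin_of_mem hs, hu, reachValue_of_mem hs]; norm_num
      · simp [reachWithin_zero_of_notMem hs]
    | succ n ih =>
      by_cases hsw : 2⁻¹ ≤ w s
      · refine le_trans ?_ (hhalf s (hsw.trans (hwu s)))
        rw [← h s]
        exact reachWithin_le_reachValue _ s
      by_cases hs : s ∈ X
      · rw [reachWithin_of_mem hs, hu, reachValue_of_mem hs]; norm_num
      · rw [reachWithin_succ_of_notMem hs, hu, reachValue_of_notMem hBU hs,
          ← hAU.const_mul (by simp) (by simp)]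
        refine (bellman_mono (supOver_isContOperator C).mono ih s).trans ?_
        exact bellman_le_bellman fun _ => supOver_mono_set (hC'neg s hsw).ge _
  -- Where `w < 1/2` this is trivial; elsewhere `C'` and `D` agree and affinity applies. At `s₀`,
  -- `3/4 ≤ 1/2 + q/2` will give `q ≥ 1/2`.
  have hwq : ∀ s, w s ≤ 2⁻¹ + 2⁻¹ * q s := by
    suffices ∀ n s, reachWithin (G.bellman (infOver D)) X n s ≤ 2⁻¹ + 2⁻¹ * q s from
      fun s => iSup_le fun n => this n s
    have hX : ∀ s ∈ X, (1 : ℝ≥0∞) ≤ 2⁻¹ + 2⁻¹ * q s := fun s hs => by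
      rw [hq, reachValue_of_mem hs, mul_one, ENNReal.inv_two_add_inv_two]
    intro n
    induction n with
    | zero =>
      intro s
      by_cases hs : s ∈ X
      · rw [reachWithin_of_mem hs]; exact hX s hs
      · simp [reachWithin_zero_of_notMem hs]
    | succ n ih =>
      intro s
      by_cases hs : s ∈ X
      · rw [reachWithin_of_mem hs]; exact hX s hs
      by_cases hsw : 2⁻¹ ≤ w s
      · rw [reachWithin_succ_of_notMem hs, hq, reachValue_of_notMem hBQ hs,
          ← hAQ _ _ _ _ (by simp) (by simp)]
        refine (hBD.mono ih s).trans ?_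
        exact bellman_le_bellman fun _ => infOver_anti_set (hC'pos s hsw).le _
      · exact (reachWithin_le_reachValue _ s).trans ((not_le.1 hsw).le.trans le_self_add)
  refine ⟨C', hC'n, hC'C, ⟨g s₀, hC'pos s₀ hs₀⟩, ?_, ?_⟩
  · refine reachValue_eq_one_of_half_le hBU hAU fun s => ?_
    rw [ENNReal.inv_le_iff_le_mul (by simp) (by simp)]
    exact hCu s
  · have h34 := hg34.trans (hwq s₀)
    have hq1 : q s₀ ≠ ∞ := ne_top_of_le_ne_top ENNReal.one_ne_top (reachValue_le_one hBQ s₀)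
    rw [← ENNReal.toReal_le_toReal (by finiteness) (by finiteness)] at h34 ⊢
    rw [ENNReal.toReal_add (by finiteness) (by finiteness), ENNReal.toReal_mul] at h34
    norm_num at h34 ⊢
    linarith

/-- In a game in which every state has value one, the maximizer has a memoryless selection that
guarantees value one from every state. -/
theorem exists_selection_value_one [Countable S] (hG : G.FinitelyBranching)
    (hC : ∀ s, (C s).Nonempty) (hf : ∀ s, (C s).Finite)
    (h : ∀ s, reachValue (G.bellman (supOver C)) X s = 1) :
    ∃ g : S → S, (∀ s, g s ∈ C s) ∧
      ∀ s, reachValue (G.bellman (infOver fun s => {g s})) X s = 1 := by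
  cases isEmpty_or_nonempty S with
  | inl _ => exact ⟨id, isEmptyElim, isEmptyElim⟩
  | inr _ =>
  obtain ⟨e, he⟩ := exists_surjective_nat S
  let Adm := {D : S → Set S // (∀ s, (D s).Nonempty) ∧ (∀ s, (D s).Finite) ∧
    ∀ s, reachValue (G.bellman (supOver D)) X s = 1}
  have hstep : ∀ (D : Adm) (s₀ : S), ∃ D' : Adm, (∀ s, D'.1 s ⊆ D.1 s) ∧ (∃ t, D'.1 s₀ = {t}) ∧
      2⁻¹ ≤ reachValue (G.bellman (infOver D'.1)) X s₀ := by
    rintro ⟨D, h1, h2, h3⟩ s₀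
    obtain ⟨D', h1', hsub, ht, h3', hv⟩ := exists_refinement hG h1 h2 h3 s₀
    exact ⟨⟨D', h1', fun s => (h2 s).subset (hsub s), h3'⟩, hsub, ht, hv⟩
  choose next hsub hfix hval using hstep
  let D : ℕ → Adm := fun n => Nat.rec ⟨C, hC, hf, h⟩ (fun n D => next D (e n)) n
  have hD : ∀ n, D (n + 1) = next (D n) (e n) := fun n => rfl
  have hanti : ∀ s, Antitone fun n => (D n).1 s := fun s =>
    antitone_nat_of_succ_le fun n => by rw [hD]; exact hsub _ _ s
  -- The choice sets decrease, stay nonempty, and are a singleton at `e k` from stage `k + 1` on.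
  have hmem : ∀ s, ∃ t, ∀ n, t ∈ (D n).1 s := by
    intro s
    obtain ⟨k, rfl⟩ := he s
    obtain ⟨t, ht⟩ := hfix (D k) (e k)
    rw [← hD] at ht
    have hlate : ∀ n, k + 1 ≤ n → t ∈ (D n).1 (e k) := by
      intro n hn
      obtain ⟨t', ht'⟩ := (D n).2.1 (e k)
      have := hanti (e k) hn ht'
      simp only [ht, Set.mem_singleton_iff] at this
      exact this ▸ ht'
    refine ⟨t, fun n => hanti (e k) (le_max_left n (k + 1)) (hlate _ (le_max_right _ _))⟩
  choose g hg using hmem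
  refine ⟨g, fun s => hg s 0, ?_⟩
  have hB : IsContOperator (G.bellman (infOver fun s => {g s})) :=
    bellman_isContOperator hG (infOver_isContOperator (by simp) (by simp))
  refine reachValue_eq_one_of_half_le hB (bellman_isAffineOperator (infOver_isAffineOperator _))
    fun s => ?_
  obtain ⟨k, rfl⟩ := he s
  refine (hval (D k) (e k)).trans ?_
  rw [← hD]
  -- The limit selection obeys the restrictions of stage `k + 1`, so it inherits their worst-case
  -- guarantee.
  refine reachValue_le_of_superharmonic
    (bellman_mono (infOver_isContOperator (D (k + 1)).2.1 (D (k + 1)).2.2.1).mono)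
    (fun s hs => (reachValue_of_mem hs).ge) (fun s hs => ?_) _
  rw [reachValue_of_notMem hB hs]
  exact bellman_le_bellman fun _ =>
    infOver_anti_set (C := fun s => {g s}) (Set.singleton_subset_iff.2 (hg s (k + 1))) _

end Selection

/-! ### Strategies against Bellman operators -/

section Strategies

variable {S : Type*} {G : StochasticGame S}

/-- In the states of `L`, the strategy `τ` moves from `s` to `g s`, whatever the history. -/
def Strategy.Follows {p : Player} (τ : G.Strategy p) (g : S → S) (L : Set S) : Prop :=
  ∀ w s (h : G.owner s = some p), s ∈ L → τ.move w s h = PMF.pure (g s)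

theorem Strategy.Follows.shift {p : Player} {τ : G.Strategy p} {g : S → S} {L : Set S}
    (h : τ.Follows g L) (s : S) : (τ.shift s).Follows g L :=
  fun w t ht hL => h (s :: w) t ht hL

/-- The MD strategy that is given by a function. -/
noncomputable def Strategy.ofSelection (p : Player) (g : S → S) (hg : ∀ s, G.trans s (g s)) :
    G.Strategy p where
  move _ s _ := PMF.pure (g s)
  move_support _ s _ := by simpa using hg s

theorem Strategy.ofSelection_isMD (p : Player) (g : S → S) (hg : ∀ s, G.trans s (g s)) :
    (Strategy.ofSelection (G := G) p g hg).IsMD :=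
  ⟨fun s _ => g s, fun _ _ _ => rfl⟩

variable {σ : G.Strategy .max} {π : G.Strategy .min} {w : List S} {s : S}

theorem step_max (h : G.owner s = some .max) : G.step σ π w s = σ.move w s h := by
  unfold step; split <;> first | rfl | (rename_i h'; simp [h] at h')

theorem step_min (h : G.owner s = some .min) : G.step σ π w s = π.move w s h := by
  unfold step; split <;> first | rfl | (rename_i h'; simp [h] at h')

theorem step_random (h : G.owner s = none) : G.step σ π w s = G.prob s h := by
  unfold step; split <;> first | rfl | (rename_i h'; simp [h] at h')

theorem PMF.tsum_mul_le_tsum_mul (p : PMF S) {f u : S → ℝ≥0∞} (h : ∀ t, p t ≠ 0 → f t ≤ u t) :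
    ∑' t, p t * f t ≤ ∑' t, p t * u t := by
  refine ENNReal.tsum_le_tsum fun t => ?_
  by_cases ht : p t = 0
  · simp [ht]
  · exact mul_le_mul_right (h t ht) _

theorem PMF.tsum_mul_const (p : PMF S) (c : ℝ≥0∞) : ∑' t, p t * c = c := by
  rw [ENNReal.tsum_mul_right, p.tsum_coe, one_mul]

theorem PMF.tsum_pure_mul (a : S) (f : S → ℝ≥0∞) : ∑' t, PMF.pure a t * f t = f a := by
  rw [tsum_eq_single a]
  · simp
  · intro t ht; simp [ht]

/-- A deficit at one point of positive mass would push the average strictly below the total mass. -/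
theorem PMF.eq_one_of_one_le_tsum_mul (p : PMF S) {f : S → ℝ≥0∞} (hf : ∀ t, f t ≤ 1)
    (h : 1 ≤ ∑' t, p t * f t) {t : S} (ht : p t ≠ 0) : f t = 1 := by
  by_contra hne
  have hlt : f t < 1 := lt_of_le_of_ne (hf t) hne
  have hle : ∀ t, p t * f t ≤ p t := fun t => mul_le_of_le_one_right' (hf t)
  have hsum : ∑' t, p t * f t ≠ ∞ :=
    ne_top_of_le_ne_top (p.tsum_coe.trans_ne ENNReal.one_ne_top) (ENNReal.tsum_le_tsum hle)
  have := ENNReal.tsum_lt_tsum hsum hle (i := t) (by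
    calc p t * f t < p t * 1 := (ENNReal.mul_lt_mul_iff_right ht (p.apply_ne_top t)).2 hlt
      _ = p t := mul_one _)
  rw [p.tsum_coe] at this
  exact absurd h (not_le.2 this)

theorem bellman_le_tsum_step {g : S → S} (hσ : σ.Follows g Set.univ) (f : S → ℝ≥0∞) :
    G.bellman (infOver fun s => {g s}) f s ≤ ∑' t, G.step σ π w s t * f t := by
  rcases G.owner_cases s with h | h | h
  · rw [bellman_max h, step_max h, hσ w s h (Set.mem_univ s), PMF.tsum_pure_mul, infOver_singleton]
  · rw [bellman_min h, step_min h, ← PMF.tsum_mul_const (π.move w s h) (infOver _ _ _)]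
    exact PMF.tsum_mul_le_tsum_mul _ fun t ht =>
      iInf_le (fun t : G.succs s => f t) ⟨t, π.move_support w s h ht⟩
  · rw [bellman_random h, step_random h]

theorem tsum_step_le_bellman {g : S → S} {L : Set S} (hπ : π.Follows g L) (hs : s ∈ L)
    {f : S → ℝ≥0∞} (hg : ∀ t ∈ G.succs s, f (g s) ≤ f t) :
    ∑' t, G.step σ π w s t * f t ≤ G.bellman (supOver G.succs) f s := by
  rcases G.owner_cases s with h | h | h
  · rw [bellman_max h, step_max h, ← PMF.tsum_mul_const (σ.move w s h) (supOver _ _ _)]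
    exact PMF.tsum_mul_le_tsum_mul _ fun t ht =>
      le_iSup (fun t : G.succs s => f t) ⟨t, σ.move_support w s h ht⟩
  · rw [bellman_min h, step_min h, hπ w s h hs, PMF.tsum_pure_mul]
    exact le_iInf fun t => hg t t.2
  · rw [bellman_random h, step_random h]

end Strategies

/-! ### From values to probabilities of visits -/

section Visits

variable {S : Type*} {G : StochasticGame S} {X T : Set S}

theorem consPlay_preimage_buchi (s : S) (T : Set S) : consPlay s ⁻¹' buchi T = buchi T := by
  ext x
  constructor
  · intro h i
    obtain ⟨j, hj, hT⟩ := h (i + 1)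
    obtain ⟨j, rfl⟩ : ∃ k, j = k + 1 := ⟨j - 1, by omega⟩
    exact ⟨j, by omega, hT⟩
  · intro h i
    obtain ⟨j, hj, hT⟩ := h i
    exact ⟨j + 1, by omega, hT⟩

/-- The plays that visit `X` up to time `n`. -/
def visitBefore (X : Set S) (n : ℕ) : Set (ℕ → S) := {x | ∃ i ≤ n, x i ∈ X}

/-- The plays that visit `X` at time `n` or later. -/
def visitAfter (X : Set S) (n : ℕ) : Set (ℕ → S) := {x | ∃ i ≥ n, x i ∈ X}

theorem buchi_eq_iInter (T : Set S) : buchi T = ⋂ n, visitAfter T n := by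
  ext x; simp [buchi, visitAfter]

theorem iUnion_visitBefore (X : Set S) : ⋃ n, visitBefore X n = visitAfter X 0 := by
  ext x
  simp only [visitBefore, visitAfter, Set.mem_iUnion, Set.mem_ofPred_eq]
  constructor
  · rintro ⟨n, i, -, h⟩; exact ⟨i, Nat.zero_le _, h⟩
  · rintro ⟨i, -, h⟩; exact ⟨i, i, le_rfl, h⟩

theorem visitBefore_mono (X : Set S) : Monotone (visitBefore X) :=
  fun _ _ h _ ⟨i, hi, hX⟩ => ⟨i, hi.trans h, hX⟩

variable [MeasurableSpace S] [DiscreteMeasurableSpace S]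

theorem measurableSet_eval (X : Set S) (i : ℕ) : MeasurableSet {x : ℕ → S | x i ∈ X} :=
  measurable_pi_apply i (MeasurableSet.of_discrete (s := X))

theorem measurableSet_visitBefore (X : Set S) (n : ℕ) : MeasurableSet (visitBefore X n) := by
  have : visitBefore X n = ⋃ i, ⋃ _ : i ≤ n, {x : ℕ → S | x i ∈ X} := by
    ext x; simp [visitBefore]
  rw [this]
  exact MeasurableSet.iUnion fun i => MeasurableSet.iUnion fun _ => measurableSet_eval X i

theorem measurableSet_visitAfter (X : Set S) (n : ℕ) : MeasurableSet (visitAfter X n) := by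
  have : visitAfter X n = ⋃ i, ⋃ _ : i ≥ n, {x : ℕ → S | x i ∈ X} := by
    ext x; simp [visitAfter]
  rw [this]
  exact MeasurableSet.iUnion fun i => MeasurableSet.iUnion fun _ => measurableSet_eval X i

theorem measurableSet_buchi (T : Set S) : MeasurableSet (buchi T) := by
  rw [buchi_eq_iInter]
  exact MeasurableSet.iInter fun n => measurableSet_visitAfter T n

variable [Countable S] {σ : G.Strategy .max} {π : G.Strategy .min} {s : S}

theorem playMeasure_ae_start : ∀ᵐ x ∂G.playMeasure s σ π, x 0 = s :=
  (mem_ae_iff_prob_eq_one (by simpa using measurableSet_eval {s} 0)).2 (playMeasure_start s σ π)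

theorem playMeasure_visitBefore_zero (hs : s ∉ X) : G.playMeasure s σ π (visitBefore X 0) = 0 := by
  refine measure_mono_null ?_ (playMeasure_ae_start (σ := σ) (π := π) (s := s))
  rintro x ⟨i, hi, hX⟩ h0
  obtain rfl : i = 0 := by omega
  exact hs (h0 ▸ hX)

/-- Büchi ignores the first state, so its probability is an average over the successors. -/
theorem playMeasure_buchi_succ (h : G.playMeasure s σ π (buchi T) = 1) {t : S}
    (ht : G.step σ π [] s t ≠ 0) :
    G.playMeasure t (σ.shift s) (π.shift s) (buchi T) = 1 := by
  rw [playMeasure_apply s σ π (measurableSet_buchi T), consPlay_preimage_buchi] at h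
  exact PMF.eq_one_of_one_le_tsum_mul _ (fun t => prob_le_one) h.ge ht

theorem reachWithin_le_playMeasure {g : S → S} (hσ : σ.Follows g Set.univ) (n : ℕ) :
    reachWithin (G.bellman (infOver fun s => {g s})) X n s ≤
      G.playMeasure s σ π (visitBefore X n) := by
  induction n generalizing s σ π with
  | zero =>
    by_cases hs : s ∈ X
    · refine (reachWithin_of_mem hs 0).trans_le ?_
      rw [← playMeasure_start s σ π]
      exact measure_mono fun x (hx : x 0 = s) => ⟨0, le_rfl, hx ▸ hs⟩
    · simp [reachWithin_zero_of_notMem hs]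
  | succ n ih =>
    by_cases hs : s ∈ X
    · refine (reachWithin_of_mem hs _).trans_le ?_
      rw [← playMeasure_start s σ π]
      exact measure_mono fun x (hx : x 0 = s) => ⟨0, Nat.zero_le _, hx ▸ hs⟩
    · rw [reachWithin_succ_of_notMem hs, playMeasure_apply s σ π (measurableSet_visitBefore X _)]
      refine (bellman_le_tsum_step (π := π) (w := []) hσ _).trans
        (PMF.tsum_mul_le_tsum_mul _ fun t _ => (ih (hσ.shift s) (π := π.shift s)).trans
          (measure_mono ?_))
      rintro x ⟨i, hi, hX⟩
      exact ⟨i + 1, by omega, hX⟩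

/-- Wherever the play is at time `n`, the shifted strategy still follows `g`, so `X` is almost
surely visited again. -/
theorem playMeasure_buchi_of_reachValue {g : S → S} (hσ : σ.Follows g Set.univ)
    (h : ∀ s, reachValue (G.bellman (infOver fun s => {g s})) X s = 1) :
    G.playMeasure s σ π (buchi X) = 1 := by
  have key : ∀ n, G.playMeasure s σ π (visitAfter X n) = 1 := by
    intro n
    induction n generalizing s σ π with
    | zero =>
      refine le_antisymm prob_le_one ?_
      rw [← h s, ← iUnion_visitBefore]
      exact iSup_le fun n => (reachWithin_le_playMeasure hσ n).trans
        (measure_mono (Set.subset_iUnion _ n))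
    | succ n ih =>
      rw [playMeasure_apply s σ π (measurableSet_visitAfter X _)]
      have : ∀ t, G.playMeasure t (σ.shift s) (π.shift s)
          (consPlay s ⁻¹' visitAfter X (n + 1)) = 1 := by
        intro t
        refine le_antisymm prob_le_one ?_
        rw [← ih (s := t) (hσ.shift s) (π := π.shift s)]
        refine measure_mono ?_
        rintro x ⟨i, hi, hX⟩
        exact ⟨i + 1, by omega, hX⟩
      simp only [this, mul_one, PMF.tsum_coe]
  rw [← mem_ae_iff_prob_eq_one (measurableSet_buchi X), buchi_eq_iInter, countable_iInter_mem]
  exact fun n => (mem_ae_iff_prob_eq_one (measurableSet_visitAfter X n)).2 (key n)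

/-- A set that is closed under the steps of the play is almost surely never left. -/
theorem playMeasure_ae_mem {W : Set S} {g : S → S} (hσ : σ.Follows g Set.univ)
    (hW : ∀ (σ : G.Strategy .max) (π : G.Strategy .min) s, σ.Follows g Set.univ → s ∈ W →
      ∀ t, G.step σ π [] s t ≠ 0 → t ∈ W) (hs : s ∈ W) (n : ℕ) :
    ∀ᵐ x ∂G.playMeasure s σ π, x n ∈ W := by
  have hm := measurableSet_eval W
  refine (mem_ae_iff_prob_eq_one (hm n)).2 ?_
  induction n generalizing s σ π with
  | zero =>
    exact (mem_ae_iff_prob_eq_one (hm 0)).1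
      (playMeasure_ae_start.mono fun x (hx : x 0 = s) => hx ▸ hs)
  | succ n ih =>
    rw [playMeasure_apply s σ π (hm _)]
    refine le_antisymm ?_ ?_
    · exact (PMF.tsum_mul_le_tsum_mul _ fun t _ => prob_le_one).trans
        (PMF.tsum_mul_const _ 1).le
    · refine (PMF.tsum_mul_const (G.step σ π [] s) 1).ge.trans
        (PMF.tsum_mul_le_tsum_mul _ fun t ht => ?_)
      exact (ih (hσ.shift s) (π := π.shift s) (hW σ π s hσ hs t ht)).ge

end Visits

/-! ### Spoiling sets and almost-sure Büchi -/

section AlmostSureBuchi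

variable {S : Type*} {G : StochasticGame S} {L L' T : Set S} {g g' : S → S}

/-- One step of the game in which the maximizer may use all successors, and the states of `L` are
losing for him. -/
noncomputable def avoidStep (G : StochasticGame S) (L : Set S) (f : S → ℝ≥0∞) (s : S) : ℝ≥0∞ :=
  Lᶜ.indicator (G.bellman (supOver G.succs) f) s

theorem avoidStep_isContOperator (hG : G.FinitelyBranching) (L : Set S) :
    IsContOperator (G.avoidStep L) := by
  have hB : IsContOperator (G.bellman (supOver G.succs)) :=
    bellman_isContOperator hG (supOver_isContOperator _)
  refine ⟨fun f f' h s => ?_, fun f hf s => ?_, fun s => ?_⟩ <;> unfold avoidStep <;>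
    by_cases hs : s ∈ L <;> simp only [hs, Set.mem_compl_iff, not_true_eq_false, not_false_eq_true,
      Set.indicator_of_notMem, Set.indicator_of_mem, le_refl, zero_le]
  · exact hB.mono h s
  · exact hB.cont f hf s
  · exact hB.le_one s

/-- The value of reaching `T` without visiting `L`. -/
noncomputable def avoidValue (G : StochasticGame S) (L T : Set S) : S → ℝ≥0∞ :=
  reachValue (G.avoidStep L) (T \ L)

theorem avoidValue_of_mem (hG : G.FinitelyBranching) {s : S} (hs : s ∈ L) :
    G.avoidValue L T s = 0 := by
  rw [avoidValue, reachValue_of_notMem (avoidStep_isContOperator hG L) (fun h => h.2 hs)]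
  simp [avoidStep, hs]

theorem avoidValue_of_notMem (hG : G.FinitelyBranching) {s : S} (hL : s ∉ L) (hT : s ∉ T) :
    G.avoidValue L T s = G.bellman (supOver G.succs) (G.avoidValue L T) s := by
  rw [avoidValue, reachValue_of_notMem (avoidStep_isContOperator hG L) (fun h => hT h.1)]
  simp [avoidStep, hL]

theorem avoidValue_le_one (hG : G.FinitelyBranching) (s : S) : G.avoidValue L T s ≤ 1 :=
  reachValue_le_one (avoidStep_isContOperator hG L) s

variable [Countable S] [MeasurableSpace S] [DiscreteMeasurableSpace S]

/-- In the states of `L`, the minimizer foils almost-sure Büchi by moving from `s` to `g s` as long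
as the play is in `L`, no matter what he does elsewhere. -/
def IsSpoiling (G : StochasticGame S) (T L : Set S) (g : S → S) : Prop :=
  (∀ s ∈ L, G.trans s (g s)) ∧ ∀ s ∈ L, ∀ (σ : G.Strategy .max) (π : G.Strategy .min),
    π.Follows g L → G.playMeasure s σ π (buchi T) < 1

/-- A play that wins almost surely is not in `L`, and neither are its successors. On `L' \ L` the
minimizer minimizes the value; outside `L'` the bound is at least one anyway. -/
theorem playMeasure_visitBefore_le_avoidValue (hG : G.FinitelyBranching)
    (hL : ∀ s ∈ L, ∀ (σ : G.Strategy .max) (π : G.Strategy .min), π.Follows g' L' →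
      G.playMeasure s σ π (buchi T) < 1)
    (hL' : ∀ s ∉ L', 1 ≤ G.bellman (supOver G.succs) (G.avoidValue L T) s)
    (hg' : ∀ s ∈ L', s ∉ L → ∀ t ∈ G.succs s, G.avoidValue L T (g' s) ≤ G.avoidValue L T t)
    (n : ℕ) {s : S} {σ : G.Strategy .max} {π : G.Strategy .min} (hπ : π.Follows g' L')
    (h : G.playMeasure s σ π (buchi T) = 1) :
    G.playMeasure s σ π (visitBefore T n) ≤ G.avoidValue L T s := by
  induction n generalizing s σ π with
  | zero =>
    have hsL : s ∉ L := fun hs => (hL s hs σ π hπ).ne h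
    by_cases hT : s ∈ T
    · exact prob_le_one.trans (reachValue_of_mem (X := T \ L) ⟨hT, hsL⟩).ge
    · simp [playMeasure_visitBefore_zero hT]
  | succ n ih =>
    have hsL : s ∉ L := fun hs => (hL s hs σ π hπ).ne h
    by_cases hT : s ∈ T
    · exact prob_le_one.trans (reachValue_of_mem (X := T \ L) ⟨hT, hsL⟩).ge
    rw [avoidValue_of_notMem hG hsL hT]
    by_cases hsL' : s ∈ L'
    · rw [playMeasure_apply s σ π (measurableSet_visitBefore T _)]
      refine (PMF.tsum_mul_le_tsum_mul _ fun t ht => ?_).trans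
        (tsum_step_le_bellman (w := []) (σ := σ) hπ hsL' (hg' s hsL' hsL))
      refine (measure_mono ?_).trans (ih (hπ.shift s) (playMeasure_buchi_succ h ht))
      rintro x ⟨i, hi, hX⟩
      cases i with
      | zero => exact absurd hX hT
      | succ i => exact ⟨i, by omega, hX⟩
    · exact prob_le_one.trans (hL' s hsL')

theorem one_le_avoidValue (hG : G.FinitelyBranching)
    (hL : ∀ s ∈ L, ∀ (σ : G.Strategy .max) (π : G.Strategy .min), π.Follows g' L' →
      G.playMeasure s σ π (buchi T) < 1)
    (hL' : ∀ s ∉ L', 1 ≤ G.bellman (supOver G.succs) (G.avoidValue L T) s)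
    (hg' : ∀ s ∈ L', s ∉ L → ∀ t ∈ G.succs s, G.avoidValue L T (g' s) ≤ G.avoidValue L T t)
    {s : S} {σ : G.Strategy .max} {π : G.Strategy .min} (hπ : π.Follows g' L')
    (h : G.playMeasure s σ π (buchi T) = 1) : 1 ≤ G.avoidValue L T s := by
  calc 1 = G.playMeasure s σ π (buchi T) := h.symm
    _ ≤ G.playMeasure s σ π (⋃ n, visitBefore T n) := by
      rw [iUnion_visitBefore, buchi_eq_iInter]
      exact measure_mono (Set.iInter_subset _ 0)
    _ = ⨆ n, G.playMeasure s σ π (visitBefore T n) := (visitBefore_mono T).measure_iUnion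
    _ ≤ G.avoidValue L T s :=
      iSup_le fun n => playMeasure_visitBefore_le_avoidValue hG hL hL' hg' n hπ h

/-- A spoiling set can be extended by the states from which, after one step, the maximizer does not
have value one for reaching `T` without visiting the spoiling set. -/
theorem IsSpoiling.extend (hG : G.FinitelyBranching) (h : G.IsSpoiling T L g) :
    ∃ g', (∀ s ∈ L, g' s = g s) ∧
      G.IsSpoiling T (L ∪ {s | G.bellman (supOver G.succs) (G.avoidValue L T) s < 1}) g' := by
  classical
  set L' := L ∪ {s | G.bellman (supOver G.succs) (G.avoidValue L T) s < 1} with hL'def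
  choose m hm hmin using fun s =>
    Set.exists_min_image (G.succs s) (G.avoidValue L T) (hG s) (G.succs_nonempty s)
  -- The old rule must be kept on `L`, both to remain spoiling there and to be comparable in Zorn's
  -- lemma.
  set g' : S → S := fun s => if s ∈ L then g s else m s with hg'def
  have hgL : ∀ s ∈ L, g' s = g s := fun s hs => if_pos hs
  have hL : ∀ s ∈ L, ∀ (σ : G.Strategy .max) (π : G.Strategy .min), π.Follows g' L' →
      G.playMeasure s σ π (buchi T) < 1 := fun s hs σ π hπ =>
    h.2 s hs σ π fun w t ht htL => by rw [hπ w t ht (Or.inl htL), hgL t htL]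
  have hL' : ∀ s ∉ L', 1 ≤ G.bellman (supOver G.succs) (G.avoidValue L T) s := fun s hs =>
    not_lt.1 fun hlt => hs (Or.inr hlt)
  have hg' : ∀ s ∈ L', s ∉ L → ∀ t ∈ G.succs s,
      G.avoidValue L T (g' s) ≤ G.avoidValue L T t := fun s _ hs t ht => by
    simpa only [hg'def, if_neg hs] using hmin s t ht
  refine ⟨g', hgL, fun s _ => ?_, fun s hs σ π hπ => ?_⟩
  · by_cases hs : s ∈ L
    · rw [hgL s hs]; exact h.1 s hs
    · simp only [hg'def, if_neg hs]; exact hm s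
  · by_cases hsL : s ∈ L
    · exact hL s hsL σ π hπ
    refine lt_of_le_of_ne prob_le_one fun hone => ?_
    have hlt : G.bellman (supOver G.succs) (G.avoidValue L T) s < 1 := hs.resolve_left hsL
    refine hlt.not_ge ?_
    -- If Büchi had probability one, every possible successor would have value one, and so would the
    -- step from `s`.
    refine le_trans ?_ (tsum_step_le_bellman (w := []) (σ := σ) hπ hs (hg' s hs hsL))
    refine (PMF.tsum_mul_const (G.step σ π [] s) 1).ge.trans
      (PMF.tsum_mul_le_tsum_mul _ fun t ht => ?_)
    exact one_le_avoidValue hG hL hL' hg' (hπ.shift s) (playMeasure_buchi_succ hone ht)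

/-- There is a largest spoiling set. -/
theorem exists_isSpoiling (hG : G.FinitelyBranching) (T : Set S) :
    ∃ (L : Set S) (g : S → S), G.IsSpoiling T L g ∧
      ∀ s ∉ L, 1 ≤ G.bellman (supOver G.succs) (G.avoidValue L T) s := by
  classical
  let P := {p : Set S × (S → S) // G.IsSpoiling T p.1 p.2}
  let r : P → P → Prop := fun a b => a.1.1 ⊆ b.1.1 ∧ ∀ s ∈ a.1.1, b.1.2 s = a.1.2 s
  obtain ⟨⟨⟨L, g⟩, hL⟩, hmax⟩ : ∃ m : P, ∀ a, r m a → r a m := by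
    refine exists_maximal_of_chains_bounded (fun c hc => ?_) fun h1 h2 =>
      ⟨h1.1.trans h2.1, fun s hs => (h2.2 s (h1.1 hs)).trans (h1.2 s hs)⟩
    let U : Set S := {s | ∃ a ∈ c, s ∈ a.1.1}
    let g : S → S := fun s => if h : ∃ a ∈ c, s ∈ a.1.1 then h.choose.1.2 s else s
    have hg : ∀ a ∈ c, ∀ s ∈ a.1.1, g s = a.1.2 s := by
      intro a ha s hs
      have h : ∃ a ∈ c, s ∈ a.1.1 := ⟨a, ha, hs⟩
      have hgs : g s = h.choose.1.2 s := dif_pos h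
      rw [hgs]
      by_cases heq : h.choose = a
      · rw [heq]
      · rcases hc h.choose_spec.1 ha heq with h' | h'
        · exact (h'.2 s h.choose_spec.2).symm
        · exact h'.2 s hs
    refine ⟨⟨(U, g), ?_, ?_⟩, fun a ha => ⟨fun s hs => ⟨a, ha, hs⟩, hg a ha⟩⟩
    · rintro s ⟨a, ha, hs⟩
      change G.trans s (g s)
      rw [hg a ha s hs]
      exact a.2.1 s hs
    · rintro s ⟨a, ha, hs⟩ σ π hπ
      -- Spoiling on the set of `a` allows any behaviour outside it, so following the larger rule
      -- does no harm.
      refine a.2.2 s hs σ π fun w t ht hta => ?_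
      rw [hπ w t ht ⟨a, ha, hta⟩]
      exact congrArg PMF.pure (hg a ha t hta)
  refine ⟨L, g, hL, fun s hs => not_lt.1 fun hlt => hs ?_⟩
  obtain ⟨g', hgg', hL'⟩ := hL.extend hG
  exact (hmax ⟨(_, g'), hL'⟩ ⟨Set.subset_union_left, hgg'⟩).1 (Or.inr hlt)

/-- Outside of a largest spoiling set, the maximizer has an MD strategy that wins almost surely. -/
theorem exists_winning_selection (hG : G.FinitelyBranching)
    (hL : ∀ s ∉ L, 1 ≤ G.bellman (supOver G.succs) (G.avoidValue L T) s) :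
    ∃ f : S → S, (∀ s, G.trans s (f s)) ∧
      ∀ s ∉ L, ∀ (σ : G.Strategy .max) (π : G.Strategy .min), σ.Follows f Set.univ →
        G.playMeasure s σ π (buchi T) = 1 := by
  classical
  set u := G.avoidValue L T with hu
  have hu1 : ∀ t, u t ≤ 1 := avoidValue_le_one hG
  have hne : ∀ t, 1 ≤ u t → t ∉ L := fun t ht htL => by
    rw [hu, avoidValue_of_mem hG htL] at ht
    simp at ht
  -- Outside `L` the maximizer is forbidden to enter `L`. A move always remains: if all successors
  -- were in `L`, the one-step value would be zero.
  set C : S → Set S := fun s =>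
    if G.owner s = some .max ∧ s ∉ L then G.succs s \ L else G.succs s with hCdef
  have hCsub : ∀ s, C s ⊆ G.succs s := fun s => by
    simp only [hCdef]; split
    exacts [Set.sdiff_subset, subset_rfl]
  have hCn : ∀ s, (C s).Nonempty := fun s => by
    simp only [hCdef]; split
    case isFalse => exact G.succs_nonempty s
    case isTrue h =>
      by_contra hemp
      have h1 := hL s h.2
      rw [bellman_max h.1] at h1
      have h0 : supOver G.succs u s ≤ 0 := iSup_le fun t => by
        have : (t : S) ∈ L := by
          by_contra htL
          exact hemp ⟨t, t.2, htL⟩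
        rw [hu, avoidValue_of_mem hG this]
      exact absurd (h1.trans h0) (by simp)
  have hCf : ∀ s, (C s).Finite := fun s => (hG s).subset (hCsub s)
  have hBC : IsContOperator (G.bellman (supOver C)) :=
    bellman_isContOperator hG (supOver_isContOperator C)
  have hstep : ∀ s ∉ L, G.bellman (supOver G.succs) u s ≤
      G.bellman (supOver C) (reachValue (G.bellman (supOver C)) (T ∪ L)) s →
      1 ≤ reachValue (G.bellman (supOver C)) (T ∪ L) s := fun s hs h => by
    by_cases hT : s ∈ T
    · exact (reachValue_of_mem (X := T ∪ L) (Or.inl hT)).ge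
    · rw [reachValue_of_notMem hBC (fun h => h.elim hT hs)]
      exact (hL s hs).trans h
  have hsup : ∀ (f : S → ℝ≥0∞) s, s ∉ L → (∀ t ∈ L, f t = 0) →
      G.bellman (supOver G.succs) f s ≤ G.bellman (supOver C) f s := fun f s hs hf0 => by
    refine bellman_le_bellman fun hmax => iSup_le fun t => ?_
    by_cases htL : (t : S) ∈ L
    · simp [hf0 t htL]
    · exact le_iSup (fun t : C s => f t) ⟨t, by simp only [hCdef, hmax, hs]; exact ⟨t.2, htL⟩⟩
  have huC : ∀ s, u s ≤ reachValue (G.bellman (supOver C)) (T ∪ L) s := by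
    intro s
    refine iSup_le fun n => ?_
    induction n generalizing s with
    | zero =>
      by_cases hs : s ∈ T \ L
      · rw [reachWithin_of_mem hs, reachValue_of_mem (X := T ∪ L) (Or.inl hs.1)]
      · simp [reachWithin_zero_of_notMem hs]
    | succ n ih =>
      by_cases hs : s ∈ T ∪ L
      · rw [reachValue_of_mem hs]
        exact (reachWithin_le_reachValue _ s).trans (hu1 s)
      · have hsT : s ∉ T := fun h => hs (Or.inl h)
        have hsL : s ∉ L := fun h => hs (Or.inr h)
        rw [reachWithin_succ_of_notMem fun h => hsT h.1, reachValue_of_notMem hBC hs]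
        simp only [avoidStep, Set.mem_compl_iff, hsL, not_false_eq_true, Set.indicator_of_mem]
        refine (hsup _ s hsL fun t ht => ?_).trans (hBC.mono ih s)
        refine le_antisymm ((reachWithin_le_reachValue n t).trans ?_) zero_le
        exact (avoidValue_of_mem (T := T) hG ht).le
  -- With `L` added to the target, every state has value one, as the selection theorem requires.
  have hone : ∀ s, reachValue (G.bellman (supOver C)) (T ∪ L) s = 1 := by
    intro s
    refine le_antisymm (reachValue_le_one hBC s) ?_
    by_cases hs : s ∈ L
    · exact (reachValue_of_mem (X := T ∪ L) (Or.inr hs)).ge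
    · refine hstep s hs ((hsup u s hs fun t ht => avoidValue_of_mem hG ht).trans ?_)
      exact hBC.mono huC s
  obtain ⟨f, hf, hfval⟩ := exists_selection_value_one hG hCn hCf hone
  refine ⟨f, fun s => hCsub s (hf s), fun s hs σ π hσ => ?_⟩
  -- At random and minimizer states outside `L`, every possible successor has `u = 1`, whereas `u =
  -- 0` on `L`.
  have hW : ∀ (σ : G.Strategy .max) (π : G.Strategy .min) s, σ.Follows f Set.univ → s ∈ Lᶜ →
      ∀ t, G.step σ π [] s t ≠ 0 → t ∈ Lᶜ := by
    intro σ π s hσ hs t ht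
    rcases G.owner_cases s with h | h | h
    · rw [step_max h, hσ _ s h (Set.mem_univ s)] at ht
      obtain rfl : t = f s := by simpa using ht
      have := hf s
      simp only [hCdef, h, true_and, if_pos (show s ∉ L from hs)] at this
      exact this.2
    · have h1 := hL s hs
      rw [bellman_min h] at h1
      rw [step_min h] at ht
      exact hne t (h1.trans (iInf_le (fun t : G.succs s => u t) ⟨t, π.move_support _ s h ht⟩))
    · have h1 := hL s hs
      rw [bellman_random h] at h1
      rw [step_random h] at ht
      exact hne t (PMF.eq_one_of_one_le_tsum_mul _ hu1 h1 ht).ge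
  have hB : ∀ᵐ x ∂G.playMeasure s σ π, x ∈ buchi (T ∪ L) :=
    (mem_ae_iff_prob_eq_one (measurableSet_buchi _)).2 (playMeasure_buchi_of_reachValue hσ hfval)
  have hmem : ∀ᵐ x ∂G.playMeasure s σ π, ∀ n, x n ∈ Lᶜ :=
    ae_all_iff.2 fun n => playMeasure_ae_mem hσ hW hs n
  refine (mem_ae_iff_prob_eq_one (measurableSet_buchi T)).1 ?_
  filter_upwards [hB, hmem] with x hx hxL i
  obtain ⟨j, hj, hjT⟩ := hx i
  exact ⟨j, hj, hjT.resolve_right (hxL j)⟩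

end AlmostSureBuchi

end StochasticGame

/-! ### Strong MD-determinacy -/

theorem theorem6 {S : Type*} [Countable S] [MeasurableSpace S] [DiscreteMeasurableSpace S]
    (G : StochasticGame S) (hG : G.FinitelyBranching) (T : Set S) :
    (∃ (σ' : G.Strategy .max) (π' : G.Strategy .min), σ'.IsMD ∧ π'.IsMD ∧
      ∀ s : S,
        (∀ π : G.Strategy .min, G.playMeasure s σ' π (buchi T) = 1) ∨
        (∀ σ : G.Strategy .max, G.playMeasure s σ π' (buchi T) < 1)) ∧
    G.StronglyMDDetermined (buchi T) (· ≥ ·) 1 := by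
  classical
  obtain ⟨L, g, hL, hmax⟩ := StochasticGame.exists_isSpoiling hG T
  obtain ⟨f, hf, hwin⟩ := StochasticGame.exists_winning_selection hG hmax
  -- Outside `L` the minimizer's move is irrelevant; `f s` merely serves as a legal successor.
  have hg : ∀ s, G.trans s (if s ∈ L then g s else f s) := fun s => by
    split
    exacts [hL.1 s ‹_›, hf s]
  set σ' : G.Strategy .max := .ofSelection .max f hf with hσ'
  set π' : G.Strategy .min := .ofSelection .min _ hg with hπ'
  have hσMD : σ'.IsMD := StochasticGame.Strategy.ofSelection_isMD _ _ _
  have hπMD : π'.IsMD := StochasticGame.Strategy.ofSelection_isMD _ _ _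
  have hσf : σ'.Follows f Set.univ := fun _ _ _ _ => rfl
  have hπg : π'.Follows g L := fun _ s _ hs => congrArg PMF.pure (if_pos hs)
  refine ⟨⟨σ', π', hσMD, hπMD, fun s => ?_⟩, fun s => ?_⟩ <;> by_cases hs : s ∈ L
  · exact Or.inr fun σ => hL.2 s hs σ π' hπg
  · exact Or.inl fun π => hwin s hs σ' π hσf
  · exact Or.inr ⟨π', hπMD, fun σ => not_le.2 (hL.2 s hs σ π' hπg)⟩
  · exact Or.inl ⟨σ', hσMD, fun π => (hwin s hs σ' π hσf).ge⟩
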